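/- Let $V$ be a finite set of $n$ players, let $\alpha>0$ and $\beta>1$ be real numbers. A state $s=(s_i)_{i\in V}$ assigns to each player $i$ a set $s_i\subseteq V\setminus\{i\}$ of players to which $i$ builds edges; $G_s$ is the undirected graph on $V$ in which $i,j$ are adjacent iff $j\in s_i$ or $i\in s_j$. The cost of player $i$ is $$c_i(s)=\alpha|s_i|+\sum_{j\neq i}\mathrm{dist}_s(i,j),$$ where $\mathrm{dist}_s(i,j)$ is the length of a shortest path from $i$ to $j$ in $G_s$ if $i,j$ lie in the same component of $G_s$. If $i,j$ lie in different components, then $\mathrm{dist}_s(i,j)=\infty$ in the network creation game (NCG) and $\mathrm{dist}_s(i,j)=\beta$ in the penalized network creation game (PCG). A social optimum is a state minimizing $\sum_{i\in V}c_i(s)$. A state $s$ is a strong equilibrium if for every coalition $C\subseteq V$ and every state $s'$ with $s'_i=s_i$ for all $i\notin C$: if $c_i(s')<c_i(s)$ for some $i\in C$, then $c_j(s')\ge c_j(s)$ for some $j\in C$. Then the following hold. 1. If $\alpha<\beta-1$, then a state is a strong equilibrium of the PCG if and only if it is a strong equilibrium of the NCG. 2. If $\alpha\ge\beta-1$, then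 some social optimum of the PCG is a strong equilibrium of the PCG, for all parameter values outside the following two exceptional ranges: (a) $\beta<3$; (b) $\beta n-2n+2-(\beta-1)<\alpha<\beta n-2n+2$. -/

import Mathlib

open Finset
open scoped ENNReal

namespace NetworkCreation

/-- A state of the game with player set `V`: every player `i` chooses a set `buys i` of other
players, to which `i` builds (and pays for) edges. -/
@[ext] structure State (V : Type*) where
  buys : V → Finset V
  not_mem_self : ∀ i, i ∉ buys i

/-- The undirected graph `G_s` induced by the state `s`. -/
def State.graph {V : Type*} (s : State V) : SimpleGraph V where
  Adj i j := j ∈ s.buys i ∨ i ∈ s.buys j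
  symm := ⟨fun _ _ h => h.symm⟩
  loopless := ⟨fun i h => h.elim (s.not_mem_self i) (s.not_mem_self i)⟩

open Classical in
/-- The distance in the penalized game: the length of a shortest path in `G_s`, and the penalty
`β` if the two players are in different components of `G_s`. -/
noncomputable def penalizedDist {V : Type*} (β : ℝ) (s : State V) (i j : V) : ℝ :=
  if s.graph.Reachable i j then (s.graph.dist i j : ℝ) else β

/-- The individual cost of player `i` in the penalized network creation game (PCG). -/
noncomputable def pcgCost {V : Type*} [Fintype V] [DecidableEq V] (α β : ℝ)
    (s : State V) (i : V) : ℝ :=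
  α * (#(s.buys i) : ℝ) + ∑ j ∈ univ.erase i, penalizedDist β s i j

/-- The individual cost of player `i` in the network creation game (NCG), a value in `[0, ∞]`:
here players in different components are at distance `∞`. -/
noncomputable def ncgCost {V : Type*} [Fintype V] [DecidableEq V] (α : ℝ)
    (s : State V) (i : V) : ℝ≥0∞ :=
  ENNReal.ofReal α * (#(s.buys i) : ℝ≥0∞) + ∑ j ∈ univ.erase i, (s.graph.edist i j : ℝ≥0∞)

/-- The social cost of a state of the PCG. -/
noncomputable def pcgSocialCost {V : Type*} [Fintype V] [DecidableEq V] (α β : ℝ)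
    (s : State V) : ℝ :=
  ∑ i, pcgCost α β s i

/-- A social optimum of the PCG: a state of minimum social cost. -/
def IsSocialOptimum {V : Type*} [Fintype V] [DecidableEq V] (α β : ℝ) (s : State V) : Prop :=
  ∀ t : State V, pcgSocialCost α β s ≤ pcgSocialCost α β t

/-- Strong equilibrium for the individual costs `cost`: whenever a coalition `C` changes its
strategies (all other players keep theirs) and some member of `C` strictly decreases its cost,
there is a member of `C` whose cost does not decrease. -/
def IsStrongEquilibrium {V R : Type*} [LinearOrder R] (cost : State V → V → R)
    (s : State V) : Prop :=
  ∀ (C : Finset V) (t : State V), (∀ i, i ∉ C → t.buys i = s.buys i) →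
    (∃ i ∈ C, cost t i < cost s i) → ∃ j ∈ C, cost s j ≤ cost t j

end NetworkCreation

namespace NetworkCreation

variable {V : Type*}

/-! A deviation matters only if every member of a nonempty coalition strictly gains.

If `α < β - 1`, an edge to an unreachable player costs `α` and saves `β - 1`. So PCG equilibria are
connected, where both costs agree, and a PCG deviation can be completed by `State.reachOut` to one
with finite NCG costs.

If `α ≥ β - 1` and `β ≥ 3`, let `n` be the number of players. With `k` components there are at least
`n - k` edges, and everyone misses at least `k - 1` players; this bounds the social cost by a
function affine in `k` (`le_pcgSocialCost`), attained by the star at `k = 1` and the empty state at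
`k = n`. The sign of its slope `(β - 2) * n + 2 - α` decides which is optimal.

For stability, all edges into the coalition are bought inside it. Improving buyers would have to
receive more edges than they build, which double counting forbids
(`State.not_adj_of_buys_lt_buyers`). Only isolation remains: it changes nothing in the empty state
and does not pay for a leaf of the star when `α ≤ (β - 2) * (n - 1) + 1`. The gap between this bound
and the optimality threshold is range (b). -/

theorem penalizedDist_of_reachable {β : ℝ} {s : State V} {i j : V} (h : s.graph.Reachable i j) :
    penalizedDist β s i j = s.graph.dist i j := by
  simp [penalizedDist, h]

theorem penalizedDist_of_not_reachable {β : ℝ} {s : State V} {i j : V}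
    (h : ¬ s.graph.Reachable i j) : penalizedDist β s i j = β := by
  simp [penalizedDist, h]

theorem penalizedDist_nonneg {β : ℝ} (hβ : 0 ≤ β) (s : State V) (i j : V) :
    0 ≤ penalizedDist β s i j := by
  unfold penalizedDist
  split_ifs
  · positivity
  · exact hβ

theorem penalizedDist_of_adj {β : ℝ} {s : State V} {i j : V} (h : s.graph.Adj i j) :
    penalizedDist β s i j = 1 := by
  rw [penalizedDist_of_reachable h.reachable, SimpleGraph.dist_eq_one_iff_adj.2 h, Nat.cast_one]

theorem one_le_penalizedDist {β : ℝ} (hβ : 1 ≤ β) (s : State V) {i j : V} (hij : i ≠ j) :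
    1 ≤ penalizedDist β s i j := by
  unfold penalizedDist
  split_ifs with h
  · exact_mod_cast h.pos_dist_of_ne hij
  · exact hβ

theorem two_le_penalizedDist {β : ℝ} (hβ : 2 ≤ β) {s : State V} {i j : V} (hij : i ≠ j)
    (h : ¬ s.graph.Adj i j) : 2 ≤ penalizedDist β s i j := by
  unfold penalizedDist
  split_ifs with hr
  · have h1 := hr.pos_dist_of_ne hij
    have h2 : s.graph.dist i j ≠ 1 := fun h' => h (SimpleGraph.dist_eq_one_iff_adj.1 h')
    exact_mod_cast (by omega : 2 ≤ s.graph.dist i j)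
  · exact hβ

/-- The state in which nobody builds an edge. -/
def emptyState (V : Type*) : State V where
  buys _ := ∅
  not_mem_self _ := by simp

theorem not_adj_emptyState (i j : V) : ¬ (emptyState V).graph.Adj i j := by
  simp [State.graph, emptyState]

/-- A representative of the component of `i`. -/
noncomputable def State.root (s : State V) (i : V) : V :=
  (s.graph.connectedComponentMk i).out

theorem State.reachable_root (s : State V) (i : V) : s.graph.Reachable (s.root i) i :=
  SimpleGraph.ConnectedComponent.exact (Quot.out_eq (s.graph.connectedComponentMk i))

theorem State.root_eq_of_reachable {s : State V} {i j : V} (h : s.graph.Reachable i j) :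
    s.root i = s.root j := by
  rw [State.root, State.root, SimpleGraph.ConnectedComponent.sound h]

section Decidable

variable [DecidableEq V]

/-- The star with centre `z` in which every leaf builds its edge to the centre. -/
def starState (z : V) : State V where
  buys i := if i = z then ∅ else {z}
  not_mem_self i := by split_ifs with h <;> simp [h]

theorem starState_adj {z i : V} (h : i ≠ z) : (starState z).graph.Adj i z := by
  left; simp [starState, h]

variable [Fintype V]

/-! ### Comparison of PCG and NCG for `α < β - 1` -/

theorem pcgCost_nonneg {α β : ℝ} (hα : 0 ≤ α) (hβ : 0 ≤ β) (s : State V) (i : V) :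
    0 ≤ pcgCost α β s i :=
  add_nonneg (by positivity) (sum_nonneg fun j _ => penalizedDist_nonneg hβ s i j)

theorem ncgCost_of_reachable {α β : ℝ} (hα : 0 ≤ α) {s : State V} {i : V}
    (h : ∀ j, s.graph.Reachable i j) : ncgCost α s i = ENNReal.ofReal (pcgCost α β s i) := by
  have hd : ∀ j, (s.graph.edist i j : ℝ≥0∞) = ENNReal.ofReal (penalizedDist β s i j) := by
    intro j
    rw [penalizedDist_of_reachable (h j), ENNReal.ofReal_natCast, ← (h j).coe_dist_eq_edist]
    rfl
  have hsum : ∀ j ∈ univ.erase i, 0 ≤ penalizedDist β s i j := fun j _ => by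
    rw [penalizedDist_of_reachable (h j)]; positivity
  rw [ncgCost, pcgCost, ENNReal.ofReal_add (by positivity) (sum_nonneg hsum),
    ENNReal.ofReal_mul hα, ENNReal.ofReal_natCast, ENNReal.ofReal_sum_of_nonneg hsum]
  simp only [hd]

theorem ncgCost_eq_top {α : ℝ} {s : State V} {i j : V}
    (h : ¬ s.graph.Reachable i j) : ncgCost α s i = ⊤ := by
  have hij : j ≠ i := fun e => h (e ▸ SimpleGraph.Reachable.refl _)
  have : (∑ j ∈ univ.erase i, (s.graph.edist i j : ℝ≥0∞)) = ⊤ := by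
    refine ENNReal.sum_eq_top.2 ⟨j, by simp [hij], ?_⟩
    rw [SimpleGraph.edist_eq_top_of_not_reachable h]
    rfl
  rw [ncgCost, this, add_top]

/-- The players that `i` cannot reach. -/
noncomputable def State.unreachable (s : State V) (i : V) : Finset V :=
  by classical exact univ.filter fun j => ¬ s.graph.Reachable i j

theorem State.mem_unreachable {s : State V} {i j : V} :
    j ∈ s.unreachable i ↔ ¬ s.graph.Reachable i j := by
  simp [State.unreachable]

theorem State.self_notMem_unreachable (s : State V) (i : V) : i ∉ s.unreachable i := by
  simp [State.mem_unreachable]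

/-- Every member of `C` additionally builds edges to all players it cannot reach. -/
noncomputable def State.reachOut (s : State V) (C : Finset V) : State V where
  buys i := if i ∈ C then s.buys i ∪ s.unreachable i else s.buys i
  not_mem_self i := by
    split_ifs
    · simp [s.not_mem_self i, s.self_notMem_unreachable i]
    · exact s.not_mem_self i

theorem State.graph_le_reachOut (s : State V) (C : Finset V) :
    s.graph ≤ (s.reachOut C).graph := by
  intro i j h
  have key : ∀ i j, j ∈ s.buys i → j ∈ (s.reachOut C).buys i := by
    intro i j h
    simp only [State.reachOut]
    split_ifs <;> simp [h]
  exact h.imp (key i j) (key j i)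

theorem State.reachOut_adj {s : State V} {C : Finset V} {i j : V} (hi : i ∈ C)
    (h : ¬ s.graph.Reachable i j) : (s.reachOut C).graph.Adj i j := by
  left
  simp [State.reachOut, hi, State.mem_unreachable, h]

theorem State.reachOut_reachable {s : State V} {C : Finset V} {i : V} (hi : i ∈ C) (j : V) :
    (s.reachOut C).graph.Reachable i j := by
  by_cases h : s.graph.Reachable i j
  · exact h.mono (s.graph_le_reachOut C)
  · exact (State.reachOut_adj hi h).reachable

/-- Each new edge costs `α` and replaces a distance `β` by `1`; no other distance from `i` grows. -/
theorem pcgCost_reachOut {α β : ℝ} (hα : 0 ≤ α) {s : State V} {C : Finset V} {i : V}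
    (hi : i ∈ C) :
    pcgCost α β (s.reachOut C) i + (β - 1 - α) * #(s.unreachable i) ≤ pcgCost α β s i := by
  have hb : (#((s.reachOut C).buys i) : ℝ) ≤ #(s.buys i) + #(s.unreachable i) := by
    have : (s.reachOut C).buys i = s.buys i ∪ s.unreachable i := by simp [State.reachOut, hi]
    rw [this]
    exact_mod_cast card_union_le _ _
  have hd : ∑ j ∈ univ.erase i, penalizedDist β (s.reachOut C) i j
      + (β - 1) * #(s.unreachable i) ≤ ∑ j ∈ univ.erase i, penalizedDist β s i j := by
    have hu : (β - 1) * (#(s.unreachable i) : ℝ)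
        = ∑ j ∈ univ.erase i, if j ∈ s.unreachable i then β - 1 else 0 := by
      rw [← sum_filter, sum_const, nsmul_eq_mul, mul_comm]
      congr 3
      ext j
      simp only [mem_filter, mem_erase, mem_univ, and_true]
      refine ⟨fun h => ⟨?_, h⟩, fun h => h.2⟩
      rintro rfl
      exact s.self_notMem_unreachable _ h
    rw [hu, ← sum_add_distrib]
    refine sum_le_sum fun j _ => ?_
    by_cases h : s.graph.Reachable i j
    · rw [if_neg (by simpa [State.mem_unreachable] using h), add_zero,
        penalizedDist_of_reachable h, penalizedDist_of_reachable (State.reachOut_reachable hi j)]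
      obtain ⟨p, hp⟩ := h.exists_walk_length_eq_dist
      rw [← hp, ← p.length_map (SimpleGraph.Hom.ofLE (s.graph_le_reachOut C))]
      exact_mod_cast SimpleGraph.dist_le _
    · rw [if_pos (State.mem_unreachable.2 h), penalizedDist_of_not_reachable h,
        penalizedDist_of_adj (State.reachOut_adj hi h)]
      linarith
  unfold pcgCost
  nlinarith [mul_le_mul_of_nonneg_left hb hα]

theorem IsStrongEquilibrium.reachable {α β : ℝ} (hα : 0 ≤ α) (h : α < β - 1) {s : State V}
    (hs : IsStrongEquilibrium (pcgCost α β) s) (i j : V) : s.graph.Reachable i j := by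
  by_contra hij
  have hlt : pcgCost α β (s.reachOut {i}) i < pcgCost α β s i := by
    have h1 := pcgCost_reachOut (β := β) hα (s := s) (mem_singleton_self i)
    have h2 : (0 : ℝ) < #(s.unreachable i) := by
      exact_mod_cast card_pos.2 ⟨j, State.mem_unreachable.2 hij⟩
    nlinarith [mul_pos (sub_pos.2 h) h2]
  obtain ⟨k, hk, hle⟩ := hs {i} (s.reachOut {i})
    (fun k hk => by simp only [State.reachOut, if_neg hk]) ⟨i, mem_singleton_self i, hlt⟩
  rw [mem_singleton.1 hk] at hle
  exact absurd hlt hle.not_gt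

theorem isStrongEquilibrium_pcg_iff_ncg {α β : ℝ} (hα : 0 < α) (hβ : 0 ≤ β) (h : α < β - 1)
    (s : State V) :
    IsStrongEquilibrium (pcgCost α β) s ↔ IsStrongEquilibrium (ncgCost α) s := by
  constructor
  · intro hs C t ht hC
    by_contra! hall
    obtain ⟨i, hi, -⟩ := hC
    have key : ∀ j ∈ C, pcgCost α β t j < pcgCost α β s j := by
      intro j hj
      have hlt := hall j hj
      -- A strict improvement forces finite cost, so `j` reaches everyone in `t`.
      have hr : ∀ k, t.graph.Reachable j k := by
        by_contra! hk
        obtain ⟨k, hk⟩ := hk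
        rw [ncgCost_eq_top hk] at hlt
        exact not_top_lt hlt
      rw [ncgCost_of_reachable (β := β) hα.le hr,
        ncgCost_of_reachable (β := β) hα.le (hs.reachable hα.le h j)] at hlt
      exact lt_of_not_ge fun hle => hlt.not_ge (ENNReal.ofReal_le_ofReal hle)
    obtain ⟨j, hj, hle⟩ := hs C t ht ⟨i, hi, key i hi⟩
    exact absurd (key j hj) hle.not_gt
  · intro hs C t ht hC
    by_contra! hall
    obtain ⟨i, hi, -⟩ := hC
    -- `t` itself may leave members at infinite NCG cost; `t.reachOut C` does not, and its PCG costs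
    -- on `C` are no larger.
    have key : ∀ j ∈ C, ncgCost α (t.reachOut C) j < ncgCost α s j := by
      intro j hj
      rw [ncgCost_of_reachable (β := β) hα.le (State.reachOut_reachable hj)]
      by_cases hr : ∀ k, s.graph.Reachable j k
      · rw [ncgCost_of_reachable (β := β) hα.le hr]
        have h1 := pcgCost_reachOut (β := β) hα.le (s := t) hj
        have h2 : 0 ≤ (β - 1 - α) * (#(t.unreachable j) : ℝ) :=
          mul_nonneg (by linarith) (by positivity)
        have h3 := hall j hj
        have h4 := pcgCost_nonneg hα.le hβ (t.reachOut C) j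
        exact (ENNReal.ofReal_lt_ofReal_iff (by linarith)).2 (by linarith)
      · push Not at hr
        obtain ⟨k, hk⟩ := hr
        rw [ncgCost_eq_top hk]
        exact ENNReal.ofReal_lt_top
    obtain ⟨j, hj, hle⟩ := hs C (t.reachOut C)
      (fun k hk => by simpa only [State.reachOut, if_neg hk] using ht k hk) ⟨i, hi, key i hi⟩
    exact absurd (key j hj) hle.not_gt

/-! ### Bounds on individual costs -/

/-- The players that build an edge to `i`. -/
def State.buyers (s : State V) (i : V) : Finset V := univ.filter fun j => i ∈ s.buys j

theorem State.mem_buyers {s : State V} {i j : V} : j ∈ s.buyers i ↔ i ∈ s.buys j := by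
  simp [State.buyers]

theorem State.sum_card_buyers (s : State V) :
    ∑ i, #(s.buyers i) = ∑ i, #(s.buys i) := by
  have := sum_card_bipartiteAbove_eq_sum_card_bipartiteBelow (s := univ) (t := univ)
    (fun i j : V => j ∈ s.buys i)
  simpa [bipartiteAbove, bipartiteBelow, State.buyers] using this.symm

theorem sum_erase_ite_mem {A : Finset V} {i : V} (hi : i ∉ A) (c : ℝ) :
    ∑ j ∈ univ.erase i, (if j ∈ A then c else 0) = c * #A := by
  rw [← sum_filter, sum_const, nsmul_eq_mul, mul_comm]
  congr 3
  ext j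
  simp only [mem_filter, mem_erase, mem_univ, and_true]
  exact ⟨fun h => h.2, fun h => ⟨fun e => hi (e ▸ h), h⟩⟩

theorem sum_erase_const (i : V) (c : ℝ) :
    ∑ _j ∈ univ.erase i, c = c * ((Fintype.card V : ℝ) - 1) := by
  have : 1 ≤ Fintype.card V := Fintype.card_pos_iff.2 ⟨i⟩
  rw [sum_const, nsmul_eq_mul, card_erase_of_mem (mem_univ i), card_univ, Nat.cast_sub this,
    Nat.cast_one, mul_comm]

/-- Adjacent players are at distance `1`, all others at distance at least `2`, and the
unreachable ones at distance `β`. -/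
theorem le_pcgCost {α β : ℝ} (hβ : 2 ≤ β) (s : State V) (i : V) :
    (α - 1) * #(s.buys i) + 2 * ((Fintype.card V : ℝ) - 1) - #(s.buyers i)
      + (β - 2) * #(s.unreachable i) ≤ pcgCost α β s i := by
  have hin : i ∉ s.buyers i := by simpa [State.mem_buyers] using s.not_mem_self i
  -- An edge bought from both ends is subtracted twice, which only weakens the bound.
  have hsum : ∑ j ∈ univ.erase i, ((((2 : ℝ) + if j ∈ s.buys i then -1 else 0)
      + if j ∈ s.buyers i then -1 else 0) + if j ∈ s.unreachable i then β - 2 else 0)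
      ≤ ∑ j ∈ univ.erase i, penalizedDist β s i j := by
    refine sum_le_sum fun j hj => ?_
    have hij : i ≠ j := (ne_of_mem_erase hj).symm
    by_cases hr : s.graph.Reachable i j
    · have hu : j ∉ s.unreachable i := by simpa [State.mem_unreachable] using hr
      rw [if_neg hu]
      by_cases ha : s.graph.Adj i j
      · rw [penalizedDist_of_adj ha]
        rcases ha with h | h
        · rw [if_pos h]; split_ifs <;> norm_num
        · rw [if_pos (State.mem_buyers.2 h)]; split_ifs <;> norm_num
      · have := two_le_penalizedDist hβ hij ha
        split_ifs <;> linarith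
    · rw [if_pos (State.mem_unreachable.2 hr), penalizedDist_of_not_reachable hr]
      split_ifs <;> linarith
  rw [sum_add_distrib, sum_add_distrib, sum_add_distrib, sum_erase_ite_mem (s.not_mem_self i),
    sum_erase_ite_mem hin, sum_erase_ite_mem (s.self_notMem_unreachable i),
    sum_erase_const] at hsum
  unfold pcgCost
  linarith

theorem pcgCost_eq_of_isolated {α β : ℝ} {s : State V} {i : V} (h : ∀ j, ¬ s.graph.Adj i j) :
    pcgCost α β s i = β * ((Fintype.card V : ℝ) - 1) := by
  have hb : s.buys i = ∅ := eq_empty_of_forall_notMem fun j hj => h j (Or.inl hj)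
  have hd : ∀ j ∈ univ.erase i, penalizedDist β s i j = β := by
    intro j hj
    refine penalizedDist_of_not_reachable fun ⟨p⟩ => ?_
    cases p with
    | nil => simp at hj
    | cons ha _ => exact h _ ha
  rw [pcgCost, hb, sum_congr rfl hd, sum_erase_const]
  simp

theorem card_sub_one_le_pcgCost {α β : ℝ} (hα : 0 ≤ α) (hβ : 1 ≤ β) (s : State V) (i : V) :
    (Fintype.card V : ℝ) - 1 ≤ pcgCost α β s i := by
  have h : ∑ _j ∈ univ.erase i, (1 : ℝ) ≤ ∑ j ∈ univ.erase i, penalizedDist β s i j :=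
    sum_le_sum fun j hj => one_le_penalizedDist hβ s (ne_of_mem_erase hj).symm
  rw [sum_erase_const] at h
  have : 0 ≤ α * (#(s.buys i) : ℝ) := by positivity
  unfold pcgCost
  linarith

theorem pcgCost_starState_center (α β : ℝ) (z : V) :
    pcgCost α β (starState z) z = (Fintype.card V : ℝ) - 1 := by
  have hd : ∀ j ∈ univ.erase z, penalizedDist β (starState z) z j = 1 := fun j hj =>
    penalizedDist_of_adj (starState_adj (ne_of_mem_erase hj)).symm
  rw [pcgCost, sum_congr rfl hd, sum_erase_const]
  simp [starState]

theorem pcgCost_starState_leaf_le (α β : ℝ) {z i : V} (hi : i ≠ z) :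
    pcgCost α β (starState z) i ≤ α + 2 * (Fintype.card V : ℝ) - 3 := by
  have hd : ∑ j ∈ univ.erase i, penalizedDist β (starState z) i j
      ≤ ∑ j ∈ univ.erase i, ((2 : ℝ) + if j ∈ ({z} : Finset V) then -1 else 0) := by
    refine sum_le_sum fun j hj => ?_
    by_cases hj : j = z
    · subst hj
      rw [penalizedDist_of_adj (starState_adj hi)]
      simp; norm_num
    · let p : (starState z).graph.Walk i j :=
        .cons (starState_adj hi) (.cons (starState_adj hj).symm .nil)
      rw [penalizedDist_of_reachable ⟨p⟩, if_neg (by simpa using hj), add_zero]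
      exact_mod_cast SimpleGraph.dist_le p
  rw [sum_add_distrib, sum_erase_const, sum_erase_ite_mem (by simpa using hi)] at hd
  have hb : (starState z).buys i = {z} := by simp [starState, hi]
  rw [pcgCost, hb]
  simp only [card_singleton, Nat.cast_one] at *
  linarith

/-! ### Components and social optima -/

/-- The chosen representatives of all components. -/
noncomputable def State.roots (s : State V) : Finset V := univ.filter fun i => s.root i = i

theorem State.mem_roots {s : State V} {i : V} : i ∈ s.roots ↔ s.root i = i := by
  simp [State.roots]

theorem State.root_mem_roots (s : State V) (i : V) : s.root i ∈ s.roots :=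
  State.mem_roots.2 (State.root_eq_of_reachable (s.reachable_root i))

/-- Every root outside the component of `i` is unreachable from `i`. -/
theorem State.card_roots_le (s : State V) (i : V) : #s.roots ≤ #(s.unreachable i) + 1 := by
  have : s.roots ⊆ insert (s.root i) (s.unreachable i) := by
    intro j hj
    by_cases h : s.graph.Reachable i j
    · rw [State.root_eq_of_reachable h, State.mem_roots.1 hj]
      exact mem_insert_self _ _
    · exact mem_insert_of_mem (State.mem_unreachable.2 h)
  exact (card_le_card this).trans (card_insert_le _ _)

/-- A graph has at least as many edges as a spanning forest of it. -/
theorem State.card_le_sum_card_buys_add_card_roots (s : State V) :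
    Fintype.card V ≤ ∑ i, #(s.buys i) + #s.roots := by
  -- The parent of a non-root is a neighbour nearer to its root.
  have hpar : ∀ v, v ∉ s.roots → ∃ w, s.graph.Adj v w ∧
      s.graph.dist (s.root v) w < s.graph.dist (s.root v) v ∧ s.root w = s.root v := by
    intro v hv
    have hne : v ≠ s.root v := fun h => hv (State.mem_roots.2 h.symm)
    have hroot : ∀ r, v ≠ r → s.graph.Reachable v r →
        ∃ w, s.graph.Adj v w ∧ s.graph.dist r w < s.graph.dist r v := by
      rintro r hr hvr
      obtain ⟨p, hp⟩ := hvr.exists_walk_length_eq_dist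
      cases p with
      | nil => exact absurd rfl hr
      | cons ha q =>
        refine ⟨_, ha, ?_⟩
        rw [SimpleGraph.Walk.length_cons, SimpleGraph.dist_comm] at hp
        rw [← hp, SimpleGraph.dist_comm]
        exact Nat.lt_succ_of_le (SimpleGraph.dist_le q)
    obtain ⟨w, ha, hw⟩ := hroot _ hne (s.reachable_root v).symm
    exact ⟨w, ha, hw, State.root_eq_of_reachable ha.symm.reachable⟩
  choose! par hpar using hpar
  -- Each parent edge is recorded as a pair (buyer, target).
  let f : V → Σ _ : V, V := fun v => if par v ∈ s.buys v then ⟨v, par v⟩ else ⟨par v, v⟩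
  have hmaps : ∀ v ∈ univ \ s.roots, f v ∈ univ.sigma fun i => s.buys i := by
    intro v hv
    simp only [mem_sdiff, mem_univ, true_and] at hv
    simp only [f]
    split_ifs with h
    · simpa using h
    · simpa using (hpar v hv).1.resolve_left h
  have hinj : Set.InjOn f (univ \ s.roots : Finset V) := by
    intro v hv w hw hvw
    simp only [coe_sdiff, coe_univ, Set.mem_sdiff, Set.mem_univ, true_and, mem_coe] at hv hw
    -- Two vertices cannot be each other's parent, since distance to the common root drops at each
    -- step.
    have hcycle : ∀ v w, v ∉ s.roots → w ∉ s.roots → w = par v → v = par w → v = w := by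
      intro v w hv hw h1 h2
      obtain ⟨-, hlt, hr⟩ := hpar v hv
      obtain ⟨-, hlt', hr'⟩ := hpar w hw
      rw [← h1] at hlt hr
      rw [← h2, hr] at hlt'
      omega
    simp only [f] at hvw
    split_ifs at hvw
    · exact congrArg Sigma.fst hvw
    · exact hcycle v w hv hw (by simpa using (congrArg Sigma.snd hvw).symm)
        (congrArg Sigma.fst hvw)
    · exact hcycle v w hv hw (congrArg Sigma.fst hvw).symm
        (by simpa using congrArg Sigma.snd hvw)
    · simpa using congrArg Sigma.snd hvw
  have h := card_le_card_of_injOn f hmaps hinj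
  rw [card_sigma, card_sdiff_of_subset (subset_univ _), card_univ] at h
  omega

/-- The social cost is at least an interpolation between the costs of the star and of the empty
state, where the parameter is the number of components. -/
theorem le_pcgSocialCost {α β : ℝ} (hα : 2 ≤ α) (hβ : 2 ≤ β) (s : State V) :
    (α - 2) * ((Fintype.card V : ℝ) - #s.roots) + 2 * (Fintype.card V : ℝ) *
      ((Fintype.card V : ℝ) - 1) + (β - 2) * (Fintype.card V : ℝ) * ((#s.roots : ℝ) - 1)
      ≤ pcgSocialCost α β s := by
  have h1 : ∀ i ∈ (univ : Finset V), (α - 1) * #(s.buys i) + 2 * ((Fintype.card V : ℝ) - 1)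
      - #(s.buyers i) + (β - 2) * ((#s.roots : ℝ) - 1) ≤ pcgCost α β s i := by
    intro i _
    have h2 : (#s.roots : ℝ) ≤ #(s.unreachable i) + 1 := by exact_mod_cast s.card_roots_le i
    have h3 := le_pcgCost (α := α) hβ s i
    have h4 := mul_le_mul_of_nonneg_left (sub_le_iff_le_add.2 h2) (sub_nonneg.2 hβ)
    linarith
  have h2 := sum_le_sum h1
  have h3 : ∑ i, (#(s.buyers i) : ℝ) = ∑ i, (#(s.buys i) : ℝ) := by
    exact_mod_cast s.sum_card_buyers
  have h4 : (Fintype.card V : ℝ) ≤ ∑ i, (#(s.buys i) : ℝ) + #s.roots := by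
    exact_mod_cast s.card_le_sum_card_buys_add_card_roots
  rw [sum_add_distrib, sum_sub_distrib, sum_add_distrib, ← mul_sum, h3] at h2
  simp only [sum_const, card_univ, nsmul_eq_mul] at h2
  unfold pcgSocialCost
  nlinarith [mul_le_mul_of_nonneg_left (sub_le_iff_le_add.2 h4) (sub_nonneg.2 hα)]

/-- Here the lower bound is nonincreasing in the number of components, and at `n` components it is
the cost of the empty state. -/
theorem isSocialOptimum_emptyState {α β : ℝ} (hβ : 2 ≤ β)
    (h : (β - 2) * Fintype.card V + 2 ≤ α) : IsSocialOptimum α β (emptyState V) := by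
  intro t
  have hα : 2 ≤ α := by
    have : 0 ≤ (β - 2) * (Fintype.card V : ℝ) := mul_nonneg (by linarith) (by positivity)
    linarith
  have h1 := le_pcgSocialCost hα hβ t
  have h2 : pcgSocialCost α β (emptyState V)
      = Fintype.card V * (β * ((Fintype.card V : ℝ) - 1)) := by
    simp [pcgSocialCost, pcgCost_eq_of_isolated (not_adj_emptyState _)]
  have h3 : (#t.roots : ℝ) ≤ Fintype.card V := by exact_mod_cast card_le_univ t.roots
  nlinarith [mul_nonneg (sub_nonneg.2 h) (sub_nonneg.2 h3)]

theorem pcgSocialCost_starState_le (α β : ℝ) (z : V) :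
    pcgSocialCost α β (starState z)
      ≤ ((Fintype.card V : ℝ) - 1) * (α + 2 * (Fintype.card V : ℝ) - 2) := by
  have h1 : ∑ i ∈ univ.erase z, pcgCost α β (starState z) i
      ≤ ∑ _i ∈ univ.erase z, (α + 2 * (Fintype.card V : ℝ) - 3) :=
    sum_le_sum fun i hi => pcgCost_starState_leaf_le α β (ne_of_mem_erase hi)
  rw [sum_erase_const] at h1
  rw [pcgSocialCost, ← add_sum_erase _ _ (mem_univ z), pcgCost_starState_center]
  linarith

/-- Here the lower bound is nondecreasing, and at one component it is the upper bound for the star.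
-/
theorem isSocialOptimum_starState {α β : ℝ} (hα : 2 ≤ α) (hβ : 2 ≤ β)
    (h : α ≤ (β - 2) * Fintype.card V + 2) (z : V) : IsSocialOptimum α β (starState z) := by
  intro t
  have h1 := le_pcgSocialCost hα hβ t
  have h2 := pcgSocialCost_starState_le α β z
  have h3 : (1 : ℝ) ≤ #t.roots := by
    exact_mod_cast card_pos.2 ⟨_, t.root_mem_roots z⟩
  nlinarith [mul_nonneg (sub_nonneg.2 h) (sub_nonneg.2 h3)]

/-! ### Stability of the empty state and of the star -/

/-- If all edges to a member of `C` are built by members of `C`, then the members of `C` receive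
at most as many edges as they build, minus the number of edges leaving `C`. -/
theorem State.sum_card_buyers_add_le {s : State V} {C : Finset V}
    (hC : ∀ i ∈ C, s.buyers i ⊆ C) :
    ∑ i ∈ C, #(s.buyers i) + ∑ i ∈ C, #(s.buys i \ C) = ∑ i ∈ C, #(s.buys i) := by
  have h := sum_card_bipartiteAbove_eq_sum_card_bipartiteBelow (s := C) (t := C)
    (fun i j : V => j ∈ s.buys i)
  have h1 : ∑ i ∈ C, #(s.buyers i) = ∑ i ∈ C, #(s.buys i ∩ C) := by
    refine Eq.trans (sum_congr rfl fun i hi => ?_) (h.symm.trans (sum_congr rfl fun i _ => ?_))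
    · congr 1
      ext j
      simp only [bipartiteBelow, mem_filter, State.mem_buyers]
      exact ⟨fun hj => ⟨hC i hi (State.mem_buyers.2 hj), hj⟩, fun hj => hj.2⟩
    · congr 1
      ext j
      simp [bipartiteAbove, and_comm]
  rw [h1, ← sum_add_distrib]
  exact sum_congr rfl fun i _ => by rw [add_comm]; exact card_sdiff_add_card_inter _ _

/-- If every member of `C` that builds edges receives more edges than it builds, all of them from
`C`, then no member of `C` has an edge. -/
theorem State.not_adj_of_buys_lt_buyers {s : State V} {C : Finset V}
    (hC : ∀ i ∈ C, s.buyers i ⊆ C)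
    (h : ∀ i ∈ C, 1 ≤ #(s.buys i) → #(s.buys i) < #(s.buyers i)) {i : V} (hi : i ∈ C) (j : V) :
    ¬ s.graph.Adj i j := by
  have hle : ∀ i ∈ C, #(s.buys i) ≤ #(s.buyers i) := fun i hi => by
    rcases Nat.eq_zero_or_pos #(s.buys i) with h0 | h0
    · omega
    · exact (h i hi h0).le
  have hsum := State.sum_card_buyers_add_le hC
  have hempty : ∀ i ∈ C, s.buys i = ∅ := by
    by_contra! hne
    obtain ⟨k, hk, hk'⟩ := hne
    have := sum_lt_sum hle ⟨k, hk, h k hk (card_pos.2 hk')⟩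
    omega
  rintro (ha | ha)
  · simp [hempty i hi] at ha
  · have hj : j ∈ C := hC i hi (State.mem_buyers.2 ha)
    simp [hempty j hj] at ha

theorem isStrongEquilibrium_emptyState {α β : ℝ} (hβ : 2 < β)
    (h : (β - 2) * Fintype.card V + 2 ≤ α) :
    IsStrongEquilibrium (pcgCost α β) (emptyState V) := by
  intro C t ht hC
  by_contra! hall
  obtain ⟨i, hi, -⟩ := hC
  have hN : (0 : ℝ) ≤ (β - 2) * Fintype.card V := mul_nonneg (by linarith) (by positivity)
  have hbuy : ∀ i ∈ C, t.buyers i ⊆ C := by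
    intro i _ j hj
    by_contra hjC
    rw [State.mem_buyers, ht j hjC] at hj
    simp [emptyState] at hj
  have hiso := State.not_adj_of_buys_lt_buyers hbuy (fun j hj hb => by
    have h1 := hall j hj
    rw [pcgCost_eq_of_isolated (not_adj_emptyState j)] at h1
    have h2 := le_pcgCost (α := α) hβ.le t j
    have h3 : 0 ≤ (β - 2) * (#(t.unreachable j) : ℝ) := mul_nonneg (by linarith) (by positivity)
    have hb' : (1 : ℝ) ≤ #(t.buys j) := by exact_mod_cast hb
    -- Beating `β * (n - 1)` requires more than `(α - 1) * #(t.buys j) - (β - 2) * (n - 1)` received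
    -- edges, and this exceeds `#(t.buys j)` by at least `β - 2`.
    have : (#(t.buys j) : ℝ) < #(t.buyers j) := by
      nlinarith [mul_nonneg (by linarith : 0 ≤ α - 2) (sub_nonneg.2 hb')]
    exact_mod_cast this) hi
  have := hall i hi
  rw [pcgCost_eq_of_isolated hiso, pcgCost_eq_of_isolated (not_adj_emptyState i)] at this
  exact lt_irrefl _ this

theorem isStrongEquilibrium_starState {α β : ℝ} (hα : 2 ≤ α) (hβ : 3 ≤ β)
    (h : α ≤ (β - 2) * ((Fintype.card V : ℝ) - 1) + 1) (z : V) :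
    IsStrongEquilibrium (pcgCost α β) (starState z) := by
  intro C t ht hC
  by_contra! hall
  obtain ⟨i, hi, -⟩ := hC
  -- The centre already has the least possible cost, `n - 1`.
  have hz : z ∉ C := by
    intro hz
    have h1 := hall z hz
    rw [pcgCost_starState_center] at h1
    linarith [card_sub_one_le_pcgCost (by linarith : 0 ≤ α) (by linarith : 1 ≤ β) t z]
  have hlt : ∀ j ∈ C, pcgCost α β t j < α + 2 * (Fintype.card V : ℝ) - 3 := fun j hj =>
    (hall j hj).trans_le (pcgCost_starState_leaf_le α β fun e => hz (e ▸ hj))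
  have hbuy : ∀ i ∈ C, t.buyers i ⊆ C := by
    intro i hi j hj
    by_contra hjC
    rw [State.mem_buyers, ht j hjC] at hj
    simp only [starState] at hj
    split_ifs at hj
    · simp at hj
    · exact hz (mem_singleton.1 hj ▸ hi)
  -- The cost bound gives this with coefficients `α - 1` and `β - 2`, both at least `1`.
  have hgain : ∀ j ∈ C, 1 ≤ #(t.buys j) →
      (#(t.buys j) : ℝ) - 1 + #(t.unreachable j) < #(t.buyers j) := by
    intro j hj hb
    have h1 := hlt j hj
    have h2 := le_pcgCost (α := α) (by linarith : 2 ≤ β) t j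
    have hb' : (1 : ℝ) ≤ #(t.buys j) := by exact_mod_cast hb
    nlinarith [mul_nonneg (by linarith : 0 ≤ α - 2) (sub_nonneg.2 hb'),
      mul_nonneg (by linarith : 0 ≤ β - 3) (Nat.cast_nonneg (α := ℝ) #(t.unreachable j))]
  have hle : ∀ j ∈ C, #(t.buys j) ≤ #(t.buyers j) := by
    intro j hj
    rcases Nat.eq_zero_or_pos #(t.buys j) with h0 | h0
    · omega
    · have h1 := hgain j hj h0
      have : (#(t.buys j) : ℝ) < #(t.buyers j) + 1 := by
        linarith [Nat.cast_nonneg (α := ℝ) #(t.unreachable j)]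
      exact Nat.lt_succ_iff.1 (by exact_mod_cast this)
  -- Summing `hle` over `C` leaves no room for an edge leaving `C`.
  have hclosed : ∀ j ∈ C, t.buys j ⊆ C := by
    have h0 : ∑ j ∈ C, #(t.buys j \ C) = 0 := by
      have h1 := State.sum_card_buyers_add_le hbuy
      have h2 := sum_le_sum hle
      omega
    intro j hj
    rw [← sdiff_eq_empty_iff_subset, ← card_eq_zero]
    exact sum_eq_zero_iff.1 h0 j hj
  have hwalk : ∀ j k, t.graph.Reachable j k → j ∈ C → k ∈ C := by
    rintro j k ⟨p⟩
    induction p with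
    | nil => exact id
    | cons ha _ ih =>
      exact fun hj => ih (ha.elim (fun h => hclosed _ hj h)
        fun h => hbuy _ hj (State.mem_buyers.2 h))
  -- Now `z` is unreachable from `C`, and this extra unit makes the inequality in `hle` strict for
  -- buyers.
  have hiso := State.not_adj_of_buys_lt_buyers hbuy (fun j hj hb => by
    have h1 := hgain j hj hb
    have h2 : (1 : ℝ) ≤ #(t.unreachable j) := by
      exact_mod_cast card_pos.2 ⟨z, State.mem_unreachable.2 fun hr => hz (hwalk j z hr hj)⟩
    have : (#(t.buys j) : ℝ) < #(t.buyers j) := by linarith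
    exact_mod_cast this) hi
  have := hlt i hi
  rw [pcgCost_eq_of_isolated hiso] at this
  linarith

end Decidable

end NetworkCreation

theorem mainTheorem6 {V : Type*} [Fintype V] [DecidableEq V] (α β : ℝ)
    (hα : 0 < α) (hβ : 1 < β) :
    (α < β - 1 → ∀ s : NetworkCreation.State V,
      NetworkCreation.IsStrongEquilibrium (NetworkCreation.pcgCost α β) s ↔
        NetworkCreation.IsStrongEquilibrium (NetworkCreation.ncgCost α) s) ∧
    (β - 1 ≤ α →
      ¬ (β < 3 ∨
        (β * (Fintype.card V : ℝ) - 2 * (Fintype.card V : ℝ) + 2 - (β - 1) < α ∧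
          α < β * (Fintype.card V : ℝ) - 2 * (Fintype.card V : ℝ) + 2)) →
      ∃ s : NetworkCreation.State V, NetworkCreation.IsSocialOptimum α β s ∧
        NetworkCreation.IsStrongEquilibrium (NetworkCreation.pcgCost α β) s) := by
  refine ⟨fun h s =>
    NetworkCreation.isStrongEquilibrium_pcg_iff_ncg hα (by linarith) h s, fun h hexc => ?_⟩
  push Not at hexc
  obtain ⟨hβ3, hexc⟩ := hexc
  by_cases hcase : (β - 2) * (Fintype.card V : ℝ) + 2 ≤ α
  · exact ⟨_, NetworkCreation.isSocialOptimum_emptyState (by linarith) hcase,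
      NetworkCreation.isStrongEquilibrium_emptyState (by linarith) hcase⟩
  · push Not at hcase
    -- The right side is the lower end of range (b).
    have hle : α ≤ (β - 2) * ((Fintype.card V : ℝ) - 1) + 1 := by
      by_contra! hlt
      linarith [hexc (by linarith)]
    -- Without players `hle` would read `α ≤ 3 - β ≤ 0`.
    have hne : Nonempty V := by
      by_contra hV
      rw [not_nonempty_iff] at hV
      simp only [Fintype.card_eq_zero, Nat.cast_zero] at hle
      linarith
    obtain ⟨z⟩ := hne
    exact ⟨_, NetworkCreation.isSocialOptimum_starState (by linarith) (by linarith) hcase.le z,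
      NetworkCreation.isStrongEquilibrium_starState (by linarith) hβ3 hle z⟩
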